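/- **Theorem.** Let $k \ge 4$ be fixed. In *multicolored $k$-cycle detection*, the input is an $n$-node graph $G$ with a (not necessarily proper) coloring of its nodes with $k$ colors, and the task is to decide whether $G$ contains a $k$-cycle as a subgraph all of whose nodes have different colors; in the *induced* version the $k$-cycle has to be an induced subgraph of $G$. The CONGEST model is the synchronous message-passing model on $G$: the nodes have unique identifiers $1,\dots,n$, each node initially knows $n$, its identifier, its color and the identifiers of its neighbors, local computation is unrestricted, and in each round each node may send to each neighbor a (possibly different) message of at most $b$ bits, where $b \le C\log n$ for a constant $C$. An algorithm decides correctly within $T$ rounds if after $T$ rounds at least one node reports "yes" when $G$ is a yes-instance, and no node reports "yes" when it is a no-instance. A deterministic algorithm solves the problem if it decides correctly on every input; a randomized algorithm (whose nodes may even share their random seed) solves it if on every input it decides correctly with probability at least $2/3$. Then any CONGEST algorithm, deterministic or randomized, that solves multicolored $k$-cycle detection, and any one that solves multicolored induced $k$-cycle detection, needs $\Omega(n/\log n)$ rounds. Precisely: for every $k \ge 4$ and every $C > 0$ there are $\alpha > 0$ and $n_0$ such that for all $n \ge n_0$ and all $b \le C \log n$, every such algorithm with bandwidth $b$ that solves either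 problem on $n$-node graphs within $T$ rounds satisfies $T \ge \alpha\, n/\log n$. -/

import Mathlib

open MeasureTheory

/-- Messages of the CONGEST model with bandwidth `b`: bit strings of length at most `b`
(the empty string plays the role of silence). -/
abbrev CongestMessage (b : ℕ) : Type := {w : List Bool // w.length ≤ b}

/-- A deterministic CONGEST algorithm for `n`-node networks whose nodes are labelled with one of
`k` input colors, with bandwidth `b`. The nodes are identified with their unique identifiers in
`Fin n`. All nodes run the same state machine; local computation is unrestricted, the states may
store everything seen so far, and the algorithm may depend on `n`, `k` and `b`. -/
structure CongestAlgorithm (n k b : ℕ) where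
  /-- local states of a node -/
  State : Type
  /-- state before the first round, computed from the identifier of the node, its input color, and
  the set of identifiers of its neighbors -/
  start : Fin n → Fin k → Set (Fin n) → State
  /-- `send s u` is the message that a node in state `s` sends in this round to its neighbor `u`
  (different neighbors may get different messages) -/
  send : State → Fin n → CongestMessage b
  /-- state update at the end of a round; the second argument gives, for each neighbor, the message
  received from it (`none` for the nodes that are not neighbors) -/
  receive : State → (Fin n → Option (CongestMessage b)) → State
  /-- current output of a node: `true` means that the node reports a yes-instance -/
  output : State → Bool

/-- A decision problem on `n`-node graphs with a (not necessarily proper) `k`-coloring. -/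
abbrev ColoredGraphProblem (n k : ℕ) : Type := SimpleGraph (Fin n) → (Fin n → Fin k) → Prop

namespace CongestAlgorithm

variable {n k b : ℕ}

open Classical in
/-- The state of every node after `t` synchronous rounds on the graph `G` with coloring `c`. In each
round messages travel along the edges of `G`, in both directions, and only there. -/
noncomputable def stateAfter (A : CongestAlgorithm n k b) (G : SimpleGraph (Fin n))
    (c : Fin n → Fin k) : ℕ → Fin n → A.State
  | 0, v => A.start v (c v) (G.neighborSet v)
  | t + 1, v => A.receive (A.stateAfter G c t v) fun u =>
      if G.Adj u v then some (A.send (A.stateAfter G c t u) v) else none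

/-- After `T` rounds, at least one node reports a yes-instance. -/
def AcceptsIn (A : CongestAlgorithm n k b) (T : ℕ) (G : SimpleGraph (Fin n))
    (c : Fin n → Fin k) : Prop :=
  ∃ v, A.output (A.stateAfter G c T v) = true

/-- `A` solves the problem `P` deterministically in `T` rounds: after `T` rounds some node reports
a yes-instance if the input is one, and no node does if it is not. -/
def SolvesIn (A : CongestAlgorithm n k b) (T : ℕ) (P : ColoredGraphProblem n k) : Prop :=
  ∀ G c, A.AcceptsIn T G c ↔ P G c

/-- The randomized algorithm `A`, which draws `ω` from `μ` and runs `A ω`, solves `P` in `T` rounds: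
on every input the outputs after `T` rounds are correct with probability at least `2/3`.
The random seed `ω` is available to all nodes; private coins are the special case in which `ω` is a
family of independent seeds, one for each identifier, and each node only uses its own seed. -/
def RandomizedSolvesIn {Ω : Type*} [MeasurableSpace Ω] (μ : Measure Ω)
    (A : Ω → CongestAlgorithm n k b) (T : ℕ) (P : ColoredGraphProblem n k) : Prop :=
  ∀ G c, MeasurableSet {ω | (A ω).AcceptsIn T G c ↔ P G c} ∧
    2 / 3 ≤ μ {ω | (A ω).AcceptsIn T G c ↔ P G c}

end CongestAlgorithm

/-- `G` contains a `k`-cycle as a (not necessarily induced) subgraph, all of whose nodes have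
different colors under the `k`-coloring `c`. -/
def HasMulticoloredCycle (n k : ℕ) : ColoredGraphProblem n k := fun G c =>
  ∃ φ : SimpleGraph.Copy (SimpleGraph.cycleGraph k) G, Function.Injective fun i => c (φ i)

/-- `G` contains a `k`-cycle as an induced subgraph, all of whose nodes have different colors under
the `k`-coloring `c`. -/
def HasMulticoloredInducedCycle (n k : ℕ) : ColoredGraphProblem n k := fun G c =>
  ∃ φ : SimpleGraph.cycleGraph k ↪g G, Function.Injective fun i => c (φ i)

/-! The proof reduces from two-party set disjointness on `m ^ 2` bits, where `m = n / k`. Arrange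
`k` layers of `m` nodes in a cycle and color each node by its layer. Between layers 0 and 1 put a
bipartite graph `x`, between layers 3 and 2 a bipartite graph `y`, and perfect matchings elsewhere.
A multicolored `k`-cycle has one node per layer, so the matchings force its `x`-edge and its
`y`-edge to be the same pair; conversely, a common pair gives such a cycle, and an induced one. Both
problems therefore decide whether `x` and `y` intersect. Only `2 * m` matching edges separate layers
0 and 1 from the rest, so `T` rounds yield a transcript with `2 ^ O(b m T)` values whose fibers are
rectangles (`hasRectangularFibers_cutTranscript`). Disjointness needs `2 ^ Ω(m ^ 2)` values
(`card_le_log_card_of_decides_intersection`), so `T = Ω(m / b)`.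

For disjointness, uniform bits `w` are divided between the players by a uniform `S`, and the bits of
both players at a random coordinate `j` are set to 1 (intersecting) or to 0 (disjoint). A transcript
with few values reveals little about a typical bit (`sum_fiberBias_sq_le`), so changing the `j`-th
bit of one player alone moves its distribution little in Hellinger distance. Rectangularity
(`transcriptCount_mul`) extends this to changing both bits, so the two cases cannot be told apart
well. -/

/-! ### Randomized communication complexity of set disjointness. -/

section Disjointness

variable {ι L : Type*} [Fintype ι] [DecidableEq ι] [Fintype L] [DecidableEq L]

lemma sum_update_add_sum_update (f : (ι → Bool) → ℝ) (j : ι) :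
    ∑ w, f (Function.update w j true) + ∑ w, f (Function.update w j false) = 2 * ∑ w, f w := by
  have hinv : Function.Involutive fun w : ι → Bool => Function.update w j (!w j) := by
    intro w
    simp
  have h : ∑ w, f (Function.update w j (!w j)) = ∑ w, f w := Equiv.sum_comp hinv.toPerm f
  rw [two_mul]
  nth_rewrite 2 [← h]
  rw [← Finset.sum_add_distrib, ← Finset.sum_add_distrib]
  refine Finset.sum_congr rfl fun w _ => ?_
  cases hw : w j
  · have : Function.update w j false = w := by rw [← hw]; simp
    rw [this]; simp [add_comm]
  · have : Function.update w j true = w := by rw [← hw]; simp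
    rw [this]; simp

/-- The sign `±1` attached to a bit. -/
def bitSign (u : Bool) : ℝ := if u then 1 else -1

lemma sum_exp_sum_mul_bitSign_le (a : ι → ℝ) :
    ∑ w : ι → Bool, Real.exp (∑ j, a j * bitSign (w j)) ≤
      2 ^ Fintype.card ι * Real.exp ((∑ j, a j ^ 2) / 2) := by
  have h : ∑ w : ι → Bool, Real.exp (∑ j, a j * bitSign (w j)) =
      ∏ j, ∑ u : Bool, Real.exp (a j * bitSign u) := by
    rw [Finset.prod_univ_sum, Fintype.piFinset_univ]
    exact Finset.sum_congr rfl fun w _ => Real.exp_sum _ _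
  have h2 : (2 : ℝ) ^ Fintype.card ι * Real.exp ((∑ j, a j ^ 2) / 2) =
      ∏ j, 2 * Real.exp (a j ^ 2 / 2) := by
    rw [Finset.prod_mul_distrib, Finset.sum_div, Real.exp_sum]
    simp
  rw [h, h2]
  refine Finset.prod_le_prod (fun j _ => Finset.sum_nonneg fun u _ => (Real.exp_pos _).le)
    fun j _ => ?_
  have := Real.cosh_le_exp_half_sq (a j)
  rw [Real.cosh_eq] at this
  simp only [Fintype.sum_bool, bitSign]
  simp
  linarith

/-- The number of strings `w` for which `F`, after the `j`-th bit is set to `u`, has value `l`. -/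
def fiberCount (F : (ι → Bool) → L) (j : ι) (u : Bool) (l : L) : ℝ :=
  ∑ w, if F (Function.update w j u) = l then 1 else 0

/-- The bias of the `j`-th bit on a fiber of `F`. -/
noncomputable def fiberBias (F : (ι → Bool) → L) (l : L) (j : ι) : ℝ :=
  (∑ w, if F w = l then bitSign (w j) else 0) / ∑ w, if F w = l then 1 else 0

omit [Fintype L] in
lemma fiberBias_mul (F : (ι → Bool) → L) (l : L) (j : ι) :
    fiberBias F l j * (∑ w, if F w = l then (1 : ℝ) else 0) =
      ∑ w, if F w = l then bitSign (w j) else 0 := by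
  by_cases h : (∑ w, if F w = l then (1 : ℝ) else 0) = 0
  · rw [h, mul_zero]
    rw [Finset.sum_eq_zero_iff_of_nonneg (fun w _ => by positivity)] at h
    refine (Finset.sum_eq_zero fun w hw => ?_).symm
    have := h w hw
    split_ifs at this ⊢ with h1
    · exact absurd this one_ne_zero
    · rfl
  · exact div_mul_cancel₀ _ h

/-- This plays the role of subadditivity of entropy. Tilting by the bias vector `a` of a fiber, the
weights `exp (⟨a, w⟩ - |a|² / 2)` sum to at most `2 ^ |ι|` over the cube. Jensen's inequality turns
the resulting exponential bound into one for the average of the exponent, which on each fiber is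
`|a|² / 2`. -/
lemma sum_fiberBias_sq_le (F : (ι → Bool) → L) :
    ∑ l, ∑ j, fiberBias F l j ^ 2 * (∑ w, if F w = l then (1 : ℝ) else 0) ≤
      2 * 2 ^ Fintype.card ι * Real.log (Fintype.card L) := by
  have : Nonempty L := ⟨F fun _ => false⟩
  set K : ℝ := 2 ^ Fintype.card ι with hK
  have hKpos : 0 < K := by positivity
  have hcardL : (0 : ℝ) < Fintype.card L := by exact_mod_cast Fintype.card_pos
  set g : (ι → Bool) → ℝ := fun w =>
    ∑ j, fiberBias F (F w) j * bitSign (w j) - (∑ j, fiberBias F (F w) j ^ 2) / 2 with hg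
  have hexp : ∑ w, Real.exp (g w) ≤ K * Fintype.card L := by
    calc ∑ w, Real.exp (g w)
        ≤ ∑ w, ∑ l, Real.exp (∑ j, fiberBias F l j * bitSign (w j) -
            (∑ j, fiberBias F l j ^ 2) / 2) :=
          -- Adding the nonnegative terms of all labels decouples the bias vector from `w`, at the
          -- cost of a factor `|L|`.
          Finset.sum_le_sum fun w _ =>
            Finset.single_le_sum (f := fun l => Real.exp (∑ j, fiberBias F l j * bitSign (w j) -
              (∑ j, fiberBias F l j ^ 2) / 2)) (fun l _ => (Real.exp_pos _).le)
              (Finset.mem_univ (F w))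
      _ = ∑ l, ∑ w : ι → Bool, Real.exp (∑ j, fiberBias F l j * bitSign (w j) -
            (∑ j, fiberBias F l j ^ 2) / 2) := Finset.sum_comm
      _ ≤ ∑ _l : L, K := by
          refine Finset.sum_le_sum fun l _ => ?_
          simp only [Real.exp_sub]
          rw [← Finset.sum_div, div_le_iff₀ (Real.exp_pos _)]
          exact sum_exp_sum_mul_bitSign_le _
      _ = K * Fintype.card L := by simp [mul_comm]
  have hcardw : (Fintype.card (ι → Bool) : ℝ) = K := by simp [hK]
  have hjensen : Real.exp (∑ w, K⁻¹ • g w) ≤ ∑ w, K⁻¹ • Real.exp (g w) :=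
    convexOn_exp.map_sum_le (fun _ _ => by positivity)
      (by rw [Finset.sum_const, nsmul_eq_mul, Finset.card_univ, hcardw]; field_simp)
      (fun _ _ => Set.mem_univ _)
  simp only [smul_eq_mul, ← Finset.mul_sum] at hjensen
  have h1 : K⁻¹ * ∑ w, g w ≤ Real.log (Fintype.card L) := by
    rw [Real.le_log_iff_exp_le hcardL]
    refine hjensen.trans ?_
    rw [inv_mul_le_iff₀ hKpos]
    exact hexp
  rw [inv_mul_le_iff₀ hKpos] at h1
  have h2 : ∑ l, ∑ j, fiberBias F l j ^ 2 * (∑ w, if F w = l then (1 : ℝ) else 0) =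
      2 * ∑ w, g w := by
    have e : ∀ f : (ι → Bool) → L → ℝ,
        ∑ w, f w (F w) = ∑ l, ∑ w, if F w = l then f w l else 0 := by
      intro f
      rw [Finset.sum_comm]
      simp
    rw [e fun w l => ∑ j, fiberBias F l j * bitSign (w j) - (∑ j, fiberBias F l j ^ 2) / 2,
      Finset.mul_sum]
    refine Finset.sum_congr rfl fun l _ => ?_
    have e1 : ∑ w, (if F w = l then ∑ j, fiberBias F l j * bitSign (w j) -
        (∑ j, fiberBias F l j ^ 2) / 2 else 0) =
        ∑ j, fiberBias F l j * (∑ w, if F w = l then bitSign (w j) else 0) -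
        (∑ j, fiberBias F l j ^ 2) / 2 * ∑ w, if F w = l then (1 : ℝ) else 0 := by
      simp only [Finset.mul_sum]
      rw [Finset.sum_comm, ← Finset.sum_sub_distrib]
      refine Finset.sum_congr rfl fun w _ => ?_
      split_ifs <;> simp
    rw [e1]
    simp only [← fiberBias_mul]
    rw [← Finset.sum_mul]
    have : ∑ j, fiberBias F l j *
        (fiberBias F l j * (∑ w, if F w = l then (1 : ℝ) else 0)) =
        (∑ j, fiberBias F l j ^ 2) * (∑ w, if F w = l then (1 : ℝ) else 0) := by
      rw [Finset.sum_mul]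
      exact Finset.sum_congr rfl fun j _ => by ring
    rw [this]
    ring
  rw [h2]
  linarith

/-- Write `√p - √q` as `(p - q) / (√p + √q)` and use `(√p + √q) ^ 2 ≥ p + q`. -/
lemma sq_sqrt_sub_sqrt_le {p q : ℝ} (hp : 0 ≤ p) (hq : 0 ≤ q) {a s : ℝ} (hs : 0 ≤ s)
    (hadd : p + q = 2 * s) (hsub : p - q = 2 * (a * s)) : (√p - √q) ^ 2 ≤ 2 * (a ^ 2 * s) := by
  rcases hs.eq_or_lt with rfl | hs
  · have : p = 0 := by linarith
    have : q = 0 := by linarith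
    simp [*]
  · have h1 : (√p - √q) ^ 2 * (√p + √q) ^ 2 = (p - q) ^ 2 := by
      rw [← mul_pow, mul_comm, ← sq_sub_sq, Real.sq_sqrt hp, Real.sq_sqrt hq]
    have h2 : 2 * s ≤ (√p + √q) ^ 2 := by
      rw [add_sq, Real.sq_sqrt hp, Real.sq_sqrt hq]
      have := mul_nonneg (Real.sqrt_nonneg p) (Real.sqrt_nonneg q)
      linarith
    have h3 : (√p - √q) ^ 2 * (2 * s) ≤ (2 * (a * s)) ^ 2 := by
      rw [← hsub, ← h1]
      exact mul_le_mul_of_nonneg_left h2 (sq_nonneg _)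
    have h4 : (2 * (a * s)) ^ 2 = 2 * (a ^ 2 * s) * (2 * s) := by ring
    rw [h4] at h3
    exact le_of_mul_le_mul_right h3 (by positivity)

lemma sum_sq_sqrt_fiberCount_sub_le (F : (ι → Bool) → L) :
    ∑ j, ∑ l, (√(fiberCount F j true l) - √(fiberCount F j false l)) ^ 2 ≤
      4 * 2 ^ Fintype.card ι * Real.log (Fintype.card L) := by
  have h : ∀ j l, (√(fiberCount F j true l) - √(fiberCount F j false l)) ^ 2 ≤
      2 * (fiberBias F l j ^ 2 * (∑ w, if F w = l then (1 : ℝ) else 0)) := by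
    intro j l
    refine sq_sqrt_sub_sqrt_le (Finset.sum_nonneg fun _ _ => by positivity)
      (Finset.sum_nonneg fun _ _ => by positivity) (Finset.sum_nonneg fun _ _ => by positivity)
      (sum_update_add_sum_update (fun w => if F w = l then 1 else 0) j) ?_
    rw [fiberBias_mul, ← sum_update_add_sum_update _ j]
    simp only [Function.update_self, bitSign, sub_eq_add_neg, ← Finset.sum_neg_distrib]
    congr 1
    refine Finset.sum_congr rfl fun w _ => ?_
    split_ifs <;> simp_all
  calc _ ≤ ∑ j, ∑ l, 2 * (fiberBias F l j ^ 2 * (∑ w, if F w = l then (1 : ℝ) else 0)) :=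
        Finset.sum_le_sum fun j _ => Finset.sum_le_sum fun l _ => h j l
    _ = 2 * ∑ l, ∑ j, fiberBias F l j ^ 2 * (∑ w, if F w = l then (1 : ℝ) else 0) := by
        rw [Finset.sum_comm]
        simp only [Finset.mul_sum]
    _ ≤ _ := by
        have := sum_fiberBias_sq_le F
        linarith

/-- The first player's part of `w`: the bits selected by `S`. -/
def leftPart (S w : ι → Bool) : ι → Bool := fun i => S i && w i

/-- The second player's part of `w`: the bits not selected by `S`. -/
def rightPart (S w : ι → Bool) : ι → Bool := fun i => !S i && w i

/-- The number of `w` for which the transcript is `l` when the players hold their parts of `w`,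
except that their `j`-th bits are `u` and `v`. -/
def transcriptCount (tr : (ι → Bool) → (ι → Bool) → L) (j : ι) (S : ι → Bool) (u v : Bool)
    (l : L) : ℝ :=
  ∑ w, if tr (Function.update (leftPart S w) j u) (Function.update (rightPart S w) j v) = l
    then 1 else 0

omit [Fintype L] in
lemma transcriptCount_nonneg (tr : (ι → Bool) → (ι → Bool) → L) (j : ι) (S : ι → Bool)
    (u v : Bool) (l : L) : 0 ≤ transcriptCount tr j S u v l :=
  Finset.sum_nonneg fun _ _ => by positivity

lemma sum_transcriptCount (tr : (ι → Bool) → (ι → Bool) → L) (j : ι) (S : ι → Bool)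
    (u v : Bool) : ∑ l, transcriptCount tr j S u v l = 2 ^ Fintype.card ι := by
  unfold transcriptCount
  rw [Finset.sum_comm]
  simp

-- If `S j` is true, then bit `j` of `w` goes to the first player and the second player's is 0. The
-- planted pair `(u, 0)` thus amounts to fixing one bit in a function of uniform bits, to which the
-- bias estimate applies.
omit [Fintype L] in
lemma transcriptCount_true_false (tr : (ι → Bool) → (ι → Bool) → L) (j : ι) (S : ι → Bool)
    (u : Bool) (l : L) : transcriptCount tr j S u false l =
      fiberCount (fun w => tr (leftPart (Function.update S j true) w)
        (rightPart (Function.update S j true) w)) j u l := by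
  refine Finset.sum_congr rfl fun w _ => ?_
  have h1 : leftPart (Function.update S j true) (Function.update w j u) =
      Function.update (leftPart S w) j u := by
    funext i
    by_cases h : i = j
    · subst h; simp [leftPart]
    · simp [leftPart, h]
  have h2 : rightPart (Function.update S j true) (Function.update w j u) =
      Function.update (rightPart S w) j false := by
    funext i
    by_cases h : i = j
    · subst h; simp [rightPart]
    · simp [rightPart, h]
  simp only [h1, h2]

omit [Fintype L] in
lemma transcriptCount_false_right (tr : (ι → Bool) → (ι → Bool) → L) (j : ι) (S : ι → Bool)
    (v : Bool) (l : L) : transcriptCount tr j S false v l =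
      fiberCount (fun w => tr (leftPart (Function.update S j false) w)
        (rightPart (Function.update S j false) w)) j v l := by
  refine Finset.sum_congr rfl fun w _ => ?_
  have h1 : leftPart (Function.update S j false) (Function.update w j v) =
      Function.update (leftPart S w) j false := by
    funext i
    by_cases h : i = j
    · subst h; simp [leftPart]
    · simp [leftPart, h]
  have h2 : rightPart (Function.update S j false) (Function.update w j v) =
      Function.update (rightPart S w) j v := by
    funext i
    by_cases h : i = j
    · subst h; simp [rightPart]
    · simp [rightPart, h]
  simp only [h1, h2]

/-- The fibers of `tr` are combinatorial rectangles. -/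
def HasRectangularFibers {X Y L : Type*} (tr : X → Y → L) : Prop :=
  ∀ x y x' y', tr x y = tr x' y' → tr x y' = tr x y

-- For fixed `S` the two players' parts of `w` are independent, so on a rectangle each count factors
-- into a term depending on `u` and one depending on `v`. The bijection behind this exchanges `w`
-- and `w'` outside `S`.
omit [Fintype L] in
lemma transcriptCount_mul (tr : (ι → Bool) → (ι → Bool) → L) (htr : HasRectangularFibers tr)
    (j : ι) (S : ι → Bool) (l : L) :
    transcriptCount tr j S false false l * transcriptCount tr j S true true l =
      transcriptCount tr j S false true l * transcriptCount tr j S true false l := by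
  have hinv : Function.Involutive fun p : (ι → Bool) × (ι → Bool) =>
      ((fun i => if S i then p.1 i else p.2 i, fun i => if S i then p.2 i else p.1 i) :
        (ι → Bool) × (ι → Bool)) := by
    rintro ⟨w, w'⟩
    ext i <;> dsimp <;> split_ifs <;> rfl
  unfold transcriptCount
  simp only [Finset.sum_mul_sum, ← Finset.sum_product', Finset.univ_product_univ]
  rw [← Equiv.sum_comp hinv.toPerm]
  refine Finset.sum_congr rfl ?_
  rintro ⟨w, w'⟩ -
  have hl : ∀ w w' : ι → Bool, leftPart S (fun i => if S i then w i else w' i) = leftPart S w := by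
    intro w w'
    funext i
    cases h : S i <;> simp [leftPart, h]
  have hr : ∀ w w' : ι → Bool, rightPart S (fun i => if S i then w i else w' i) = rightPart S w' := by
    intro w w'
    funext i
    cases h : S i <;> simp [rightPart, h]
  simp only [Function.Involutive.coe_toPerm, hl, hr, ← ite_and, mul_ite, mul_one, mul_zero]
  refine if_congr ?_ rfl rfl
  have key : ∀ x y x' y', tr x y = l ∧ tr x' y' = l → tr x y' = l ∧ tr x' y = l := by
    rintro x y x' y' ⟨h1, h2⟩
    exact ⟨(htr _ _ _ _ (h1.trans h2.symm)).trans h1, (htr _ _ _ _ (h2.trans h1.symm)).trans h2⟩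
  constructor
  · rintro ⟨h1, h2⟩
    have := key _ _ _ _ ⟨h1, h2⟩
    tauto
  · rintro ⟨h1, h2⟩
    have := key _ _ _ _ ⟨h1, h2⟩
    tauto

omit [DecidableEq L] in
/-- A cut-and-paste estimate: if `p₀₀ p₁₁ = p₀₁ p₁₀`, then the total variation distance between
`p₀₀` and `p₁₁` is controlled by the Hellinger distances of `p₀₀` to `p₀₁` and `p₁₀`. -/
lemma sum_sub_le_of_mul_eq_mul (p00 p01 p10 p11 : L → ℝ) (h00 : ∀ l, 0 ≤ p00 l)
    (h01 : ∀ l, 0 ≤ p01 l) (h10 : ∀ l, 0 ≤ p10 l) (h11 : ∀ l, 0 ≤ p11 l) {K : ℝ}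
    (s00 : ∑ l, p00 l = K) (s01 : ∑ l, p01 l = K) (s10 : ∑ l, p10 l = K) (s11 : ∑ l, p11 l = K)
    (hmul : ∀ l, p00 l * p11 l = p01 l * p10 l) (s : Finset L) :
    ∑ l ∈ s, (p11 l - p00 l) ≤ K / 6 +
      12 * (∑ l, (√(p10 l) - √(p00 l)) ^ 2 + ∑ l, (√(p01 l) - √(p00 l)) ^ 2) := by
  -- The weights 6 and 1/24 in the AM-GM inequality make the second term sum to at most `K / 6`,
  -- half of the advantage `K / 3` that a correct protocol has.
  have hle : ∀ l, |p11 l - p00 l| ≤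
      6 * (√(p11 l) - √(p00 l)) ^ 2 + (√(p11 l) + √(p00 l)) ^ 2 / 24 := by
    intro l
    have e : p11 l - p00 l = (√(p11 l) - √(p00 l)) * (√(p11 l) + √(p00 l)) := by
      rw [mul_comm, ← sq_sub_sq, Real.sq_sqrt (h11 l), Real.sq_sqrt (h00 l)]
    rw [e, abs_le]
    constructor
    · nlinarith [sq_nonneg (12 * (√(p11 l) - √(p00 l)) + (√(p11 l) + √(p00 l)))]
    · nlinarith [sq_nonneg (12 * (√(p11 l) - √(p00 l)) - (√(p11 l) + √(p00 l)))]
  have hsum1 : ∑ l, (√(p11 l) + √(p00 l)) ^ 2 ≤ 4 * K := by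
    calc ∑ l, (√(p11 l) + √(p00 l)) ^ 2 ≤ ∑ l, (2 * p11 l + 2 * p00 l) := by
          refine Finset.sum_le_sum fun l _ => ?_
          nlinarith [sq_nonneg (√(p11 l) - √(p00 l)), Real.sq_sqrt (h11 l), Real.sq_sqrt (h00 l)]
      _ = 4 * K := by
          rw [Finset.sum_add_distrib, ← Finset.mul_sum, ← Finset.mul_sum, s11, s00]
          ring
  -- For equal total masses the Hellinger distance depends only on the pointwise products, which
  -- agree by `hmul`.
  have hsum2 : ∑ l, (√(p11 l) - √(p00 l)) ^ 2 = ∑ l, (√(p01 l) - √(p10 l)) ^ 2 := by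
    have e : ∀ p q : L → ℝ, (∀ l, 0 ≤ p l) → (∀ l, 0 ≤ q l) → ∑ l, p l = K → ∑ l, q l = K →
        ∑ l, (√(p l) - √(q l)) ^ 2 = 2 * K - 2 * ∑ l, √(p l * q l) := by
      intro p q hp hq sp sq
      rw [two_mul K]
      nth_rewrite 1 [← sp]
      rw [← sq, Finset.mul_sum, ← Finset.sum_add_distrib, ← Finset.sum_sub_distrib]
      refine Finset.sum_congr rfl fun l _ => ?_
      rw [sub_sq, Real.sq_sqrt (hp l), Real.sq_sqrt (hq l), Real.sqrt_mul (hp l)]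
      ring
    rw [e _ _ h11 h00 s11 s00, e _ _ h01 h10 s01 s10]
    simp only [← hmul, mul_comm]
  have hsum3 : ∑ l, (√(p01 l) - √(p10 l)) ^ 2 ≤
      2 * (∑ l, (√(p10 l) - √(p00 l)) ^ 2 + ∑ l, (√(p01 l) - √(p00 l)) ^ 2) := by
    rw [← Finset.sum_add_distrib, Finset.mul_sum]
    refine Finset.sum_le_sum fun l _ => ?_
    nlinarith [sq_nonneg ((√(p10 l) - √(p00 l)) + (√(p01 l) - √(p00 l)))]
  calc ∑ l ∈ s, (p11 l - p00 l) ≤ ∑ l ∈ s, |p11 l - p00 l| :=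
        Finset.sum_le_sum fun l _ => le_abs_self _
    _ ≤ ∑ l, |p11 l - p00 l| :=
        Finset.sum_le_univ_sum_of_nonneg fun l => abs_nonneg _
    _ ≤ ∑ l, (6 * (√(p11 l) - √(p00 l)) ^ 2 + (√(p11 l) + √(p00 l)) ^ 2 / 24) :=
        Finset.sum_le_sum fun l _ => hle l
    _ = 6 * ∑ l, (√(p11 l) - √(p00 l)) ^ 2 + (∑ l, (√(p11 l) + √(p00 l)) ^ 2) / 24 := by
        rw [Finset.sum_add_distrib, ← Finset.mul_sum, Finset.sum_div]
    _ ≤ _ := by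
        rw [hsum2]
        linarith

/-- The advantage of a deterministic protocol on the hard distribution for set disjointness. -/
lemma sum_advantage_le (tr : (ι → Bool) → (ι → Bool) → L) (htr : HasRectangularFibers tr)
    (acc : Finset L) :
    ∑ j, ∑ S, ∑ w, ((if tr (Function.update (leftPart S w) j true)
        (Function.update (rightPart S w) j true) ∈ acc then (1 : ℝ) else 0) -
      if tr (Function.update (leftPart S w) j false)
        (Function.update (rightPart S w) j false) ∈ acc then 1 else 0) ≤
      (2 ^ Fintype.card ι) ^ 2 * (Fintype.card ι / 6 + 96 * Real.log (Fintype.card L)) := by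
  set K : ℝ := 2 ^ Fintype.card ι with hK
  set F : (ι → Bool) → (ι → Bool) → L := fun S w => tr (leftPart S w) (rightPart S w) with hF
  set H : ι → (ι → Bool) → ℝ := fun j S =>
    ∑ l, (√(fiberCount (F S) j true l) - √(fiberCount (F S) j false l)) ^ 2 with hH
  have hstep : ∀ j S, ∑ w, ((if tr (Function.update (leftPart S w) j true)
        (Function.update (rightPart S w) j true) ∈ acc then (1 : ℝ) else 0) -
      if tr (Function.update (leftPart S w) j false)
        (Function.update (rightPart S w) j false) ∈ acc then 1 else 0) ≤
      K / 6 + 12 * (H j (Function.update S j true) + H j (Function.update S j false)) := by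
    intro j S
    have e : ∀ u v, ∑ w, (if tr (Function.update (leftPart S w) j u)
        (Function.update (rightPart S w) j v) ∈ acc then (1 : ℝ) else 0) =
        ∑ l ∈ acc, transcriptCount tr j S u v l := by
      intro u v
      unfold transcriptCount
      rw [Finset.sum_comm]
      simp
    rw [Finset.sum_sub_distrib, e, e, ← Finset.sum_sub_distrib]
    have := sum_sub_le_of_mul_eq_mul _ _ _ _ (transcriptCount_nonneg tr j S false false)
      (transcriptCount_nonneg tr j S false true) (transcriptCount_nonneg tr j S true false)
      (transcriptCount_nonneg tr j S true true) (sum_transcriptCount tr j S _ _)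
      (sum_transcriptCount tr j S _ _) (sum_transcriptCount tr j S _ _)
      (sum_transcriptCount tr j S _ _) (transcriptCount_mul tr htr j S) acc
    refine this.trans (le_of_eq ?_)
    congr 3
    · simp only [transcriptCount_true_false, hH, hF]
    · simp only [transcriptCount_false_right, hH, hF]
  have hcardw : (Fintype.card (ι → Bool) : ℝ) = K := by simp [hK]
  calc _ ≤ ∑ j, ∑ S, (K / 6 +
          12 * (H j (Function.update S j true) + H j (Function.update S j false))) :=
        Finset.sum_le_sum fun j _ => Finset.sum_le_sum fun S _ => hstep j S
    -- Summed over all `S`, the two resettings of `S j` hit every set twice, hence 24 = 12 * 2.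
    _ = ∑ j, (K ^ 2 / 6 + 24 * ∑ S, H j S) := by
        refine Finset.sum_congr rfl fun j _ => ?_
        rw [Finset.sum_add_distrib, ← Finset.mul_sum, Finset.sum_add_distrib,
          sum_update_add_sum_update (H j), Finset.sum_const, Finset.card_univ, nsmul_eq_mul, hcardw]
        ring
    _ = Fintype.card ι * (K ^ 2 / 6) + 24 * ∑ S, ∑ j, H j S := by
        rw [Finset.sum_add_distrib, ← Finset.mul_sum, Finset.sum_comm]
        simp
    _ ≤ Fintype.card ι * (K ^ 2 / 6) + 24 * ∑ _S : ι → Bool,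
          4 * K * Real.log (Fintype.card L) := by
        gcongr with S
        exact sum_sq_sqrt_fiberCount_sub_le (F S)
    _ = _ := by
        rw [Finset.sum_const, Finset.card_univ, nsmul_eq_mul, hcardw]
        ring

/-- The easy direction of Yao's principle. `P i` and `Q i` stand for correctness on the `i`-th yes-
and no-instance; each `i` contributes at least `2/3 - 1/3` in expectation, while every fixed seed
gives at most `B`. -/
lemma card_le_of_forall_sum_indicator_le {Ω I : Type*} [MeasurableSpace Ω] (μ : Measure Ω)
    [IsProbabilityMeasure μ] [Fintype I] (P Q : I → Set Ω) (hP : ∀ i, MeasurableSet (P i))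
    (hQ : ∀ i, MeasurableSet (Q i)) (hPμ : ∀ i, 2 / 3 ≤ μ (P i)) (hQμ : ∀ i, 2 / 3 ≤ μ (Q i))
    (B : ℝ) (hB : ∀ ω, ∑ i, ((P i).indicator 1 ω - (1 - (Q i).indicator 1 ω)) ≤ B) :
    (Fintype.card I : ℝ) / 3 ≤ B := by
  have hint : ∀ s : Set Ω, MeasurableSet s → Integrable (s.indicator (1 : Ω → ℝ)) μ :=
    fun s hs => (integrable_const (1 : ℝ)).indicator hs
  have hreal : ∀ s : Set Ω, 2 / 3 ≤ μ s → 2 / 3 ≤ μ.real s := by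
    intro s hs
    have := ENNReal.toReal_mono (measure_ne_top μ s) hs
    simpa [Measure.real] using this
  have hsub : ∀ i, Integrable (fun ω => (P i).indicator (1 : Ω → ℝ) ω -
      (1 - (Q i).indicator 1 ω)) μ := fun i =>
    (hint _ (hP i)).sub ((integrable_const 1).sub (hint _ (hQ i)))
  calc (Fintype.card I : ℝ) / 3 = ∑ _i : I, (1 / 3 : ℝ) := by simp [div_eq_mul_inv]
    _ ≤ ∑ i, ∫ ω, ((P i).indicator (1 : Ω → ℝ) ω - (1 - (Q i).indicator 1 ω)) ∂μ := by
        refine Finset.sum_le_sum fun i _ => ?_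
        have h1 := hreal _ (hPμ i)
        have h2 := hreal _ (hQμ i)
        have e1 : ∫ ω, ((P i).indicator (1 : Ω → ℝ) ω - (1 - (Q i).indicator 1 ω)) ∂μ =
            ∫ ω, (P i).indicator (1 : Ω → ℝ) ω ∂μ - ∫ ω, (1 - (Q i).indicator 1 ω) ∂μ :=
          integral_sub (hint _ (hP i)) ((integrable_const 1).sub (hint _ (hQ i)))
        have e2 : ∫ ω, (1 - (Q i).indicator (1 : Ω → ℝ) ω) ∂μ =
            ∫ _ω, (1 : ℝ) ∂μ - ∫ ω, (Q i).indicator (1 : Ω → ℝ) ω ∂μ :=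
          integral_sub (integrable_const 1) (hint _ (hQ i))
        rw [e1, e2, integral_indicator_one (hP i), integral_indicator_one (hQ i)]
        simp
        linarith
    _ = ∫ ω, ∑ i, ((P i).indicator (1 : Ω → ℝ) ω - (1 - (Q i).indicator 1 ω)) ∂μ :=
        (integral_finsetSum _ fun i _ => hsub i).symm
    _ ≤ ∫ _ω, B ∂μ := integral_mono (integrable_finsetSum _ fun i _ => hsub i)
        (integrable_const _) hB
    _ = B := by simp

/-- The randomized communication lower bound for set disjointness: a random rectangular transcript
function that decides with probability `2/3` whether the inputs intersect takes `2 ^ Ω(|ι|)`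
values. -/
theorem card_le_log_card_of_decides_intersection {Ω : Type*} [MeasurableSpace Ω] (μ : Measure Ω)
    [IsProbabilityMeasure μ] (tr : Ω → (ι → Bool) → (ι → Bool) → L)
    (htr : ∀ ω, HasRectangularFibers (tr ω)) (acc : Finset L)
    (hmeas : ∀ x y, MeasurableSet {ω | tr ω x y ∈ acc ↔ ∃ i, x i = true ∧ y i = true})
    (hprob : ∀ x y, 2 / 3 ≤ μ {ω | tr ω x y ∈ acc ↔ ∃ i, x i = true ∧ y i = true}) :
    (Fintype.card ι : ℝ) ≤ 576 * Real.log (Fintype.card L) := by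
  set E : (ι → Bool) → (ι → Bool) → Set Ω :=
    fun x y => {ω | tr ω x y ∈ acc ↔ ∃ i, x i = true ∧ y i = true} with hE
  set K : ℝ := 2 ^ Fintype.card ι with hK
  have h := card_le_of_forall_sum_indicator_le (I := ι × (ι → Bool) × (ι → Bool)) μ
    (fun p => E (Function.update (leftPart p.2.1 p.2.2) p.1 true)
      (Function.update (rightPart p.2.1 p.2.2) p.1 true))
    (fun p => E (Function.update (leftPart p.2.1 p.2.2) p.1 false)
      (Function.update (rightPart p.2.1 p.2.2) p.1 false))
    (fun p => hmeas _ _) (fun p => hmeas _ _) (fun p => hprob _ _) (fun p => hprob _ _)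
    (K ^ 2 * (Fintype.card ι / 6 + 96 * Real.log (Fintype.card L))) ?_
  · have hcard : (Fintype.card (ι × (ι → Bool) × (ι → Bool)) : ℝ) = K ^ 2 * Fintype.card ι := by
      simp [hK]
      ring
    rw [hcard, mul_div_assoc] at h
    have := le_of_mul_le_mul_left h (by positivity)
    linarith
  · intro ω
    -- Being correct means accepting on the intersecting inputs and rejecting on the disjoint ones,
    -- so the indicators become acceptance indicators.
    refine le_trans (le_of_eq ?_) (sum_advantage_le (tr ω) (htr ω) acc)
    rw [Fintype.sum_prod_type]
    refine Finset.sum_congr rfl fun j _ => ?_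
    rw [Fintype.sum_prod_type]
    refine Finset.sum_congr rfl fun S _ => Finset.sum_congr rfl fun w _ => ?_
    have h1 : ∃ i, Function.update (leftPart S w) j true i = true ∧
        Function.update (rightPart S w) j true i = true := ⟨j, by simp⟩
    have h0 : ¬ ∃ i, Function.update (leftPart S w) j false i = true ∧
        Function.update (rightPart S w) j false i = true := by
      rintro ⟨i, hi⟩
      by_cases hij : i = j
      · subst hij
        simp at hi
      · simp [hij, leftPart, rightPart] at hi
        simp [hi.1.1] at hi
    simp only [hE, Set.indicator_apply, Set.mem_ofPred_eq, h1, h0, iff_true, iff_false,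
      Pi.one_apply]
    split_ifs <;> simp_all

end Disjointness

/-! ### Two-party simulation of CONGEST algorithms across a cut. -/

namespace CongestAlgorithm

variable {n k b : ℕ}

/-- A fixed-size encoding of messages. -/
def encodeMessage (w : CongestMessage b) : Fin b → Option Bool := fun i => w.1[(i : ℕ)]?

lemma encodeMessage_injective : Function.Injective (encodeMessage (b := b)) := by
  rintro ⟨w, hw⟩ ⟨w', hw'⟩ h
  refine Subtype.ext (List.ext_getElem? fun i => ?_)
  -- Reading past the end of a list gives `none`, so the encoding also records the length.
  by_cases hi : i < b
  · exact congrFun h ⟨i, hi⟩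
  · rw [List.getElem?_eq_none (hw.trans (not_lt.1 hi)), List.getElem?_eq_none (hw'.trans (not_lt.1 hi))]

/-- What a two-party simulation of `T` rounds exchanges: the messages sent over the edges of the cut
`E` in both directions, and whether some node on either side accepts. -/
abbrev CutTranscript (n b T : ℕ) (E : Finset (Fin n × Fin n)) : Type :=
  (Fin T → E → (Fin b → Option Bool) × (Fin b → Option Bool)) × Bool × Bool

open Classical in
/-- The transcript of the simulation in which one party owns the nodes in `S`. -/
noncomputable def cutTranscript (A : CongestAlgorithm n k b) (T : ℕ) (S : Set (Fin n))
    (E : Finset (Fin n × Fin n)) (G : SimpleGraph (Fin n)) (c : Fin n → Fin k) :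
    CutTranscript n b T E :=
  (fun t e => (encodeMessage (A.send (A.stateAfter G c t e.1.1) e.1.2),
      encodeMessage (A.send (A.stateAfter G c t e.1.2) e.1.1)),
    decide (∃ v ∈ S, A.output (A.stateAfter G c T v) = true),
    decide (∃ v ∉ S, A.output (A.stateAfter G c T v) = true))

lemma acceptsIn_iff_cutTranscript (A : CongestAlgorithm n k b) (T : ℕ) (S : Set (Fin n))
    (E : Finset (Fin n × Fin n)) (G : SimpleGraph (Fin n)) (c : Fin n → Fin k) :
    A.AcceptsIn T G c ↔ ((A.cutTranscript T S E G c).2.1 || (A.cutTranscript T S E G c).2.2) := by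
  simp only [AcceptsIn, cutTranscript, Bool.or_eq_true, decide_eq_true_eq]
  constructor
  · rintro ⟨v, hv⟩
    by_cases h : v ∈ S
    · exact Or.inl ⟨v, h, hv⟩
    · exact Or.inr ⟨v, h, hv⟩
  · rintro (⟨v, -, hv⟩ | ⟨v, -, hv⟩) <;> exact ⟨v, hv⟩

/-- If `A` sends the same messages over the cut on two inputs, then on the input that mixes them every
node behaves as on the input that determines its side. -/
lemma stateAfter_eq_of_cutTranscript_eq (A : CongestAlgorithm n k b) (T : ℕ) (S : Set (Fin n))
    (E : Finset (Fin n × Fin n)) (G₁ G₂ G : SimpleGraph (Fin n)) (c : Fin n → Fin k)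
    (h₁ : ∀ u ∈ S, ∀ v, G.Adj u v ↔ G₁.Adj u v) (h₂ : ∀ u ∉ S, ∀ v, G.Adj u v ↔ G₂.Adj u v)
    (hE : ∀ u ∈ S, ∀ v ∉ S, G.Adj u v → (u, v) ∈ E)
    (htr : A.cutTranscript T S E G₁ c = A.cutTranscript T S E G₂ c) (t : ℕ) (ht : t ≤ T) :
    (∀ v ∈ S, A.stateAfter G c t v = A.stateAfter G₁ c t v) ∧
      ∀ v ∉ S, A.stateAfter G c t v = A.stateAfter G₂ c t v := by
  have hmsg : ∀ s < T, ∀ e : E,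
      A.send (A.stateAfter G₁ c s e.1.1) e.1.2 = A.send (A.stateAfter G₂ c s e.1.1) e.1.2 ∧
      A.send (A.stateAfter G₁ c s e.1.2) e.1.1 = A.send (A.stateAfter G₂ c s e.1.2) e.1.1 := by
    intro s hs e
    have := congrFun (congrFun (congrArg Prod.fst htr) ⟨s, hs⟩) e
    exact ⟨encodeMessage_injective (congrArg Prod.fst this),
      encodeMessage_injective (congrArg Prod.snd this)⟩
  induction t with
  | zero =>
    constructor
    · intro v hv
      have : G.neighborSet v = G₁.neighborSet v := Set.ext fun u => h₁ v hv u
      simp [stateAfter, this]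
    · intro v hv
      have : G.neighborSet v = G₂.neighborSet v := Set.ext fun u => h₂ v hv u
      simp [stateAfter, this]
  | succ t ih =>
    obtain ⟨ih₁, ih₂⟩ := ih (by omega)
    constructor
    · intro v hv
      rw [stateAfter, stateAfter, ih₁ v hv]
      congr 1
      funext u
      have hadj : G.Adj u v ↔ G₁.Adj u v := by
        rw [G.adj_comm, G₁.adj_comm, h₁ v hv]
      by_cases huv : G.Adj u v
      · rw [if_pos huv, if_pos (hadj.1 huv)]
        by_cases hu : u ∈ S
        · rw [ih₁ u hu]
        · rw [ih₂ u hu, (hmsg t (by omega) ⟨(v, u), hE v hv u hu huv.symm⟩).2]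
      · rw [if_neg huv, if_neg (mt hadj.2 huv)]
    · intro v hv
      rw [stateAfter, stateAfter, ih₂ v hv]
      congr 1
      funext u
      have hadj : G.Adj u v ↔ G₂.Adj u v := by
        rw [G.adj_comm, G₂.adj_comm, h₂ v hv]
      by_cases huv : G.Adj u v
      · rw [if_pos huv, if_pos (hadj.1 huv)]
        by_cases hu : u ∈ S
        · rw [ih₁ u hu, (hmsg t (by omega) ⟨(u, v), hE u hu v hv huv⟩).1]
        · rw [ih₂ u hu]
      · rw [if_neg huv, if_neg (mt hadj.2 huv)]

/-- In the mixed input `(x, y')` the nodes of `S` behave as in `(x, y)` and the others as in `(x',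
y')`. Every transcript entry depends on the state of a single node or on the nodes of a single side,
and so takes the common value. -/
lemma hasRectangularFibers_cutTranscript {X Y : Type*} (A : CongestAlgorithm n k b) (T : ℕ)
    (S : Set (Fin n)) (E : Finset (Fin n × Fin n)) (G : X → Y → SimpleGraph (Fin n))
    (c : Fin n → Fin k) (hX : ∀ x y y', ∀ u ∈ S, ∀ v, (G x y).Adj u v ↔ (G x y').Adj u v)
    (hY : ∀ x x' y, ∀ u ∉ S, ∀ v, (G x y).Adj u v ↔ (G x' y).Adj u v)
    (hE : ∀ x y, ∀ u ∈ S, ∀ v ∉ S, (G x y).Adj u v → (u, v) ∈ E) :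
    HasRectangularFibers fun x y => A.cutTranscript T S E (G x y) c := by
  intro x y x' y' h
  have hst := A.stateAfter_eq_of_cutTranscript_eq T S E (G x y) (G x' y') (G x y') c
    (hX x y' y) (hY x x' y') (hE x y') h
  have h1 := congrArg Prod.fst h
  have h2 := congrArg (fun p => p.2.2) h
  have hS : ∀ v ∈ S, A.stateAfter (G x y') c T v = A.stateAfter (G x y) c T v := (hst T le_rfl).1
  have hS' : ∀ v ∉ S, A.stateAfter (G x y') c T v = A.stateAfter (G x' y') c T v :=
    (hst T le_rfl).2
  refine Prod.ext ?_ (Prod.ext ?_ ?_)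
  · funext t e
    obtain ⟨⟨u, v⟩, he⟩ := e
    have h1' := congrFun (congrFun h1 t) ⟨(u, v), he⟩
    obtain ⟨ha, hb⟩ := hst t t.2.le
    simp only [cutTranscript] at h1' ⊢
    obtain ⟨h3, h4⟩ := Prod.ext_iff.1 h1'
    refine Prod.ext ?_ ?_
    · by_cases hu : u ∈ S
      · simp only [ha u hu]
      · simp only [hb u hu]
        exact h3.symm
    · by_cases hv : v ∈ S
      · simp only [ha v hv]
      · simp only [hb v hv]
        exact h4.symm
  · simp only [cutTranscript]
    exact decide_eq_decide.2 (exists_congr fun v => and_congr_right fun hv => by rw [hS v hv])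
  · refine Eq.trans ?_ h2.symm
    simp only [cutTranscript]
    exact decide_eq_decide.2 (exists_congr fun v => and_congr_right fun hv => by rw [hS' v hv])

/-- There are `3 ^ b` codes per message, two messages per edge and round, and two final bits; the
rest is `log 3 ≤ 2` and `log 4 ≤ 2`. -/
lemma log_card_cutTranscript_le (n b T : ℕ) (E : Finset (Fin n × Fin n)) :
    Real.log (Fintype.card (CutTranscript n b T E)) ≤ 4 * (b * E.card * T) + 2 := by
  have hcard : Fintype.card (CutTranscript n b T E) = ((3 ^ b * 3 ^ b) ^ E.card) ^ T * (2 * 2) := by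
    simp
  have h3 : Real.log 3 ≤ 2 := by
    have := Real.log_le_sub_one_of_pos (show (0 : ℝ) < 3 by norm_num)
    linarith
  have h2 : Real.log 2 ≤ 1 := by
    have := Real.log_le_sub_one_of_pos (show (0 : ℝ) < 2 by norm_num)
    linarith
  have h4 : Real.log 4 = 2 * Real.log 2 := by
    rw [show (4 : ℝ) = 2 ^ 2 by norm_num, Real.log_pow]
    norm_num
  rw [hcard]
  push_cast
  rw [Real.log_mul (by positivity) (by norm_num), Real.log_pow, Real.log_pow,
    Real.log_mul (by positivity) (by positivity), Real.log_pow]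
  rw [h4]
  have : (0 : ℝ) ≤ b * E.card * T := by positivity
  nlinarith

/-- The cut-simulation bound: if graphs `G x y` have an intersection instance `(x, y)` encoded in
them, with `x` and `y` on the two sides of a small cut, then a solution takes many rounds. -/
theorem RandomizedSolvesIn.card_le {ι Ω : Type*} [Fintype ι] [MeasurableSpace Ω] {μ : Measure Ω}
    [IsProbabilityMeasure μ] {A : Ω → CongestAlgorithm n k b} {T : ℕ}
    {P : ColoredGraphProblem n k} (hA : RandomizedSolvesIn μ A T P)
    (S : Set (Fin n)) (E : Finset (Fin n × Fin n)) (G : (ι → Bool) → (ι → Bool) → SimpleGraph (Fin n))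
    (c : Fin n → Fin k) (hX : ∀ x y y', ∀ u ∈ S, ∀ v, (G x y).Adj u v ↔ (G x y').Adj u v)
    (hY : ∀ x x' y, ∀ u ∉ S, ∀ v, (G x y).Adj u v ↔ (G x' y).Adj u v)
    (hE : ∀ x y, ∀ u ∈ S, ∀ v ∉ S, (G x y).Adj u v → (u, v) ∈ E)
    (hP : ∀ x y, P (G x y) c ↔ ∃ i, x i = true ∧ y i = true) :
    (Fintype.card ι : ℝ) ≤ 576 * (4 * (b * E.card * T) + 2) := by
  classical
  have hset : ∀ x y, {ω | (A ω).cutTranscript T S E (G x y) c ∈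
      Finset.univ.filter (fun l : CutTranscript n b T E => (l.2.1 || l.2.2) = true) ↔
        ∃ i, x i = true ∧ y i = true} = {ω | (A ω).AcceptsIn T (G x y) c ↔ P (G x y) c} := by
    intro x y
    ext ω
    simp only [Set.mem_ofPred_eq, Finset.mem_filter, Finset.mem_univ, true_and, hP,
      acceptsIn_iff_cutTranscript (A ω) T S E]
  refine (card_le_log_card_of_decides_intersection μ
    (fun ω x y => (A ω).cutTranscript T S E (G x y) c)
    (fun ω => hasRectangularFibers_cutTranscript (A ω) T S E G c hX hY hE)
    (Finset.univ.filter fun l => (l.2.1 || l.2.2) = true) ?_ ?_).trans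
    (mul_le_mul_of_nonneg_left (log_card_cutTranscript_le n b T E) (by norm_num))
  · intro x y
    rw [hset]
    exact (hA _ _).1
  · intro x y
    rw [hset]
    exact (hA _ _).2

end CongestAlgorithm

/-! ### The layered graph encoding a disjointness instance. -/

section LayeredGraph

variable {k m : ℕ}

lemma fin_add_four_val (k : ℕ) : ((1 : Fin (k + 4)) : ℕ) = 1 ∧ ((2 : Fin (k + 4)) : ℕ) = 2 ∧
    ((3 : Fin (k + 4)) : ℕ) = 3 := by
  refine ⟨?_, ?_, ?_⟩ <;> rw [Fin.coe_ofNat_eq_mod, Nat.mod_eq_of_lt (by omega)]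

lemma fin_add_four_literals_ne (k : ℕ) : (1 : Fin (k + 4)) ≠ 0 ∧ (2 : Fin (k + 4)) ≠ 0 ∧
    (3 : Fin (k + 4)) ≠ 0 ∧ (2 : Fin (k + 4)) ≠ 1 ∧ (3 : Fin (k + 4)) ≠ 1 ∧
    (3 : Fin (k + 4)) ≠ 2 := by
  obtain ⟨h1, h2, h3⟩ := fin_add_four_val k
  simp only [ne_eq, Fin.ext_iff, h1, h2, h3, Fin.val_zero]
  omega

lemma fin_one_add_one (k : ℕ) : (1 : Fin (k + 4)) + 1 = 2 := by
  obtain ⟨h1, h2, h3⟩ := fin_add_four_val k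
  rw [Fin.ext_iff, Fin.val_add, h1, h2, Nat.mod_eq_of_lt (by omega)]

lemma fin_two_add_one (k : ℕ) : (2 : Fin (k + 4)) + 1 = 3 := by
  obtain ⟨h1, h2, h3⟩ := fin_add_four_val k
  rw [Fin.ext_iff, Fin.val_add, h1, h2, h3, Nat.mod_eq_of_lt (by omega)]

/-- The edges from layer `i` to layer `i + 1` of the layered graph: the bipartite graph `x` between
layers `0` and `1`, the bipartite graph `y` between layers `3` and `2`, and perfect matchings between
all other consecutive layers. -/
def LayerStep (x y : Fin m × Fin m → Bool) (p q : Fin (k + 4) × Fin m) : Prop :=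
  q.1 = p.1 + 1 ∧
    if p.1 = 0 then x (p.2, q.2) = true else if p.1 = 2 then y (q.2, p.2) = true else p.2 = q.2

/-- The cyclically layered graph that encodes the pair `(x, y)`. -/
def layeredGraph (k : ℕ) (x y : Fin m × Fin m → Bool) : SimpleGraph (Fin (k + 4) × Fin m) where
  Adj p q := LayerStep x y p q ∨ LayerStep x y q p
  symm := ⟨fun _ _ h => h.symm⟩
  loopless := ⟨fun p h => by
    have h : p.1 = p.1 + 1 := by rcases h with h | h <;> exact h.1
    simp at h⟩

/-- The orientation is unambiguous, since stepping forward twice does not return to the same layer.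
-/
lemma layerStep_of_adj {x y : Fin m × Fin m → Bool} {p q : Fin (k + 4) × Fin m}
    (h : (layeredGraph k x y).Adj p q) (hpq : q.1 = p.1 + 1) : LayerStep x y p q := by
  rcases h with h | h
  · exact h
  · have h1 := h.1
    rw [hpq, add_assoc, left_eq_add, fin_one_add_one] at h1
    exact absurd h1 (fin_add_four_literals_ne k).2.1

/-- A transversal closed walk through the layers witnesses an intersection. -/
lemma exists_of_forall_layerStep {x y : Fin m × Fin m → Bool} (a : Fin (k + 4) → Fin m)
    (h : ∀ i, LayerStep x y (i, a i) (i + 1, a (i + 1))) : ∃ e, x e = true ∧ y e = true := by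
  obtain ⟨n10, n20, -, n21, -, -⟩ := fin_add_four_literals_ne k
  have hstep : ∀ i : Fin (k + 4), i ≠ 0 → i ≠ 2 → a i = a (i + 1) := by
    intro i h0 h2
    simpa [h0, h2] using (h i).2
  have h0 : x (a 0, a 1) = true := by simpa using (h 0).2
  have h1 : a 1 = a 2 := by
    rw [hstep 1 n10 n21.symm, fin_one_add_one]
  have h2 : y (a 3, a 2) = true := by
    have := (h 2).2
    simp only [fin_two_add_one] at this
    simpa [n20] using this
  obtain ⟨v1, v2, v3⟩ := fin_add_four_val k
  have h3 : ∀ (j : ℕ) (hj : j + 3 < k + 4), a 3 = a ⟨j + 3, hj⟩ := by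
    intro j
    induction j with
    | zero => exact fun hj => congrArg a (Fin.ext v3)
    | succ j ih =>
      intro hj
      rw [ih (by omega), hstep]
      · congr 1
        rw [Fin.ext_iff, Fin.val_add, v1, Nat.mod_eq_of_lt (by dsimp only; omega)]
      · simp [Fin.ext_iff]
      · rw [ne_eq, Fin.ext_iff, v2]
        dsimp only
        omega
  have h4 : a 3 = a 0 := by
    rw [h3 k (by omega), hstep]
    · congr 1
      rw [Fin.ext_iff, Fin.val_add, v1]
      simp
    · simp [Fin.ext_iff]
    · rw [ne_eq, Fin.ext_iff, v2]
      dsimp only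
      omega
  exact ⟨(a 0, a 1), h0, by rw [← h4, h1, h2]⟩

lemma cycleGraph_adj_iff_eq_add_one {i j : Fin (k + 4)} :
    (SimpleGraph.cycleGraph (k + 4)).Adj i j ↔ j = i + 1 ∨ i = j + 1 := by
  rw [SimpleGraph.cycleGraph_adj (n := k + 2), sub_eq_iff_eq_add', sub_eq_iff_eq_add', or_comm]

variable {n : ℕ}

lemma hasMulticoloredInducedCycle_of_mem {x y : Fin m × Fin m → Bool}
    (f : Fin (k + 4) × Fin m ↪ Fin n) (c : Fin n → Fin (k + 4)) (hc : ∀ p, c (f p) = p.1)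
    (h : ∃ e, x e = true ∧ y e = true) :
    HasMulticoloredInducedCycle n (k + 4) ((layeredGraph k x y).map f) c := by
  obtain ⟨n10, n20, n30, n21, n31, n32⟩ := fin_add_four_literals_ne k
  obtain ⟨⟨a, b⟩, hx, hy⟩ := h
  -- The index changes from `a` to `b` along the `x`-edge and back along the `y`-edge. With one node
  -- per layer there can be no chords.
  set g : Fin (k + 4) → Fin (k + 4) × Fin m := fun i => (i, if i = 1 ∨ i = 2 then b else a) with hg
  have hstep : ∀ i j, LayerStep x y (g i) (g j) ↔ j = i + 1 := by
    intro i j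
    refine ⟨fun h => h.1, ?_⟩
    rintro rfl
    refine ⟨rfl, ?_⟩
    by_cases h0 : i = 0
    · subst h0
      simpa [hg, n10.symm, n20.symm] using hx
    by_cases h2 : i = 2
    · subst h2
      simpa [hg, fin_two_add_one, n20, n31, n32] using hy
    by_cases h1 : i = 1
    · subst h1
      simp [hg, n10, n21.symm, fin_one_add_one k]
    · have h1' : i + 1 ≠ 2 := by
        rw [← fin_one_add_one k]
        exact fun h => h1 (add_right_cancel h)
      simp [hg, h0, h1, h2, h1']
  let ψ : SimpleGraph.cycleGraph (k + 4) ↪g layeredGraph k x y :=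
    { toFun := g
      inj' := fun i j h => congrArg Prod.fst h
      map_rel_iff' := by
        intro i j
        rw [cycleGraph_adj_iff_eq_add_one, ← hstep, ← hstep]
        rfl }
  refine ⟨(SimpleGraph.Embedding.map f _).comp ψ, fun i j h => ?_⟩
  have e : ∀ i, c (((SimpleGraph.Embedding.map f _).comp ψ) i) = i := fun i => hc (g i)
  simpa only [e] using h

/-- The colors along the cycle define an injective endomorphism `σ` of the finite graph `cycleGraph
(k + 4)`. It permutes the darts, so the cycle crosses between each two consecutive layers and is a
transversal closed walk up to reparametrization. -/
lemma exists_mem_of_hasMulticoloredCycle {x y : Fin m × Fin m → Bool}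
    (f : Fin (k + 4) × Fin m ↪ Fin n) (c : Fin n → Fin (k + 4)) (hc : ∀ p, c (f p) = p.1)
    (h : HasMulticoloredCycle n (k + 4) ((layeredGraph k x y).map f) c) :
    ∃ e, x e = true ∧ y e = true := by
  obtain ⟨φ, hφ⟩ := h
  have hadj : ∀ i j, (SimpleGraph.cycleGraph (k + 4)).Adj i j → ∃ p q,
      (layeredGraph k x y).Adj p q ∧ f p = φ i ∧ f q = φ j := by
    intro i j hij
    exact (SimpleGraph.map_adj _ _ _ _).1 (φ.toHom.map_adj hij)
  set σ : Fin (k + 4) → Fin (k + 4) := fun i => c (φ i) with hσ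
  have hσadj : ∀ i j, (SimpleGraph.cycleGraph (k + 4)).Adj i j →
      (SimpleGraph.cycleGraph (k + 4)).Adj (σ i) (σ j) := by
    intro i j hij
    obtain ⟨p, q, hpq, hp, hq⟩ := hadj i j hij
    rw [hσ]
    simp only [← hp, ← hq, hc]
    rw [cycleGraph_adj_iff_eq_add_one]
    exact hpq.imp (fun h => h.1) (fun h => h.1)
  have hsurj : Function.Surjective
      (fun d : {d : Fin (k + 4) × Fin (k + 4) // (SimpleGraph.cycleGraph (k + 4)).Adj d.1 d.2} =>
        (⟨(σ d.1.1, σ d.1.2), hσadj _ _ d.2⟩ :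
          {d : Fin (k + 4) × Fin (k + 4) // (SimpleGraph.cycleGraph (k + 4)).Adj d.1 d.2})) := by
    refine Finite.surjective_of_injective ?_
    rintro ⟨⟨i, j⟩, hij⟩ ⟨⟨i', j'⟩, hij'⟩ h
    have h' := congrArg Subtype.val h
    simp only [Prod.mk.injEq] at h'
    exact Subtype.ext (Prod.ext (hφ h'.1) (hφ h'.2))
  have hedge : ∀ i, ∃ s t p q, σ s = i ∧ σ t = i + 1 ∧ LayerStep x y p q ∧ f p = φ s ∧
      f q = φ t := by
    intro i
    obtain ⟨⟨⟨s, t⟩, hst⟩, he⟩ := hsurj ⟨(i, i + 1), cycleGraph_adj_iff_eq_add_one.2 (Or.inl rfl)⟩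
    have he := congrArg Subtype.val he
    simp only [Prod.mk.injEq] at he
    obtain ⟨p, q, hpq, hp, hq⟩ := hadj s t hst
    refine ⟨s, t, p, q, he.1, he.2, layerStep_of_adj hpq ?_, hp, hq⟩
    rw [← hc p, ← hc q, hp, hq]
    exact he.2.trans (by rw [← he.1])
  choose s t p q hs ht hpq hp hq using hedge
  have hp1 : ∀ i, (p i).1 = i := fun i => by rw [← hc, hp]; exact hs i
  have hqp : ∀ i, q i = p (i + 1) := by
    intro i
    apply f.injective
    rw [hq, hp, hφ ((ht i).trans (hs (i + 1)).symm)]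
  refine exists_of_forall_layerStep (fun i => (p i).2) fun i => ?_
  have := hpq i
  rw [hqp] at this
  convert this using 1
  · exact Prod.ext (hp1 i).symm rfl
  · exact Prod.ext (hp1 (i + 1)).symm rfl

/-- The nodes of the layers `0` and `1`. -/
def firstLayers (f : Fin (k + 4) × Fin m ↪ Fin n) : Set (Fin n) := f '' {p | p.1 = 0 ∨ p.1 = 1}

/-- The edges that leave the layers `0` and `1`. -/
def cutEdges (f : Fin (k + 4) × Fin m ↪ Fin n) : Finset (Fin n × Fin n) :=
  Finset.univ.image (fun a => (f (1, a), f (2, a))) ∪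
    Finset.univ.image fun a => (f (0, a), f (-1, a))

lemma card_cutEdges_le (f : Fin (k + 4) × Fin m ↪ Fin n) : (cutEdges f).card ≤ 2 * m := by
  refine (Finset.card_union_le _ _).trans ?_
  rw [two_mul]
  exact Nat.add_le_add (Finset.card_image_le.trans (by simp)) (Finset.card_image_le.trans (by simp))

lemma map_layeredGraph_adj_congr_right (f : Fin (k + 4) × Fin m ↪ Fin n)
    (x y y' : Fin m × Fin m → Bool) (u : Fin n) (hu : u ∈ firstLayers f) (v : Fin n) :
    ((layeredGraph k x y).map f).Adj u v ↔ ((layeredGraph k x y').map f).Adj u v := by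
  obtain ⟨n10, n20, n30, n21, n31, n32⟩ := fin_add_four_literals_ne k
  obtain ⟨p, hp, rfl⟩ := hu
  simp only [SimpleGraph.map_adj]
  refine exists_congr fun p' => exists_congr fun q => ?_
  by_cases hpp : p' = p
  · subst hpp
    refine and_congr_left fun _ => or_congr ?_ ?_
    · refine and_congr_right fun _ => ?_
      have : p'.1 ≠ 2 := by
        rcases hp with h | h <;> rw [h]
        exacts [n20.symm, n21.symm]
      simp only [this, if_false]
    · refine and_congr_right fun h1 => ?_
      have : q.1 ≠ 2 := by
        intro h
        rw [h, fin_two_add_one] at h1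
        rcases hp with h | h <;> rw [h] at h1
        exacts [n30 h1.symm, n31 h1.symm]
      simp only [this, if_false]
  · have : f p' ≠ f p := fun h => hpp (f.injective h)
    simp [this]

lemma map_layeredGraph_adj_congr_left (f : Fin (k + 4) × Fin m ↪ Fin n)
    (x x' y : Fin m × Fin m → Bool) (u : Fin n) (hu : u ∉ firstLayers f) (v : Fin n) :
    ((layeredGraph k x y).map f).Adj u v ↔ ((layeredGraph k x' y).map f).Adj u v := by
  simp only [SimpleGraph.map_adj]
  refine exists_congr fun p => exists_congr fun q => and_congr_left fun hpq => ?_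
  have hp : ¬ (p.1 = 0 ∨ p.1 = 1) := fun h => hu ⟨p, h, hpq.1⟩
  rw [not_or] at hp
  refine or_congr ?_ ?_
  · simp only [LayerStep, hp.1, if_false]
  · refine and_congr_right fun h1 => ?_
    have : q.1 ≠ 0 := by
      intro h
      rw [h, zero_add] at h1
      exact hp.2 h1
    simp only [this, if_false]

lemma mem_cutEdges (f : Fin (k + 4) × Fin m ↪ Fin n) (x y : Fin m × Fin m → Bool) (u : Fin n)
    (hu : u ∈ firstLayers f) (v : Fin n) (hv : v ∉ firstLayers f)
    (huv : ((layeredGraph k x y).map f).Adj u v) : (u, v) ∈ cutEdges f := by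
  obtain ⟨n10, n20, n30, n21, n31, n32⟩ := fin_add_four_literals_ne k
  obtain ⟨⟨i, a⟩, ⟨j, b⟩, h, rfl, rfl⟩ := (SimpleGraph.map_adj _ _ _ _).1 huv
  obtain ⟨p, hp, hpe⟩ := hu
  obtain rfl := f.injective hpe
  have hq : ¬ (j = 0 ∨ j = 1) := fun h => hv ⟨(j, b), h, rfl⟩
  rw [not_or] at hq
  rw [cutEdges, Finset.mem_union, Finset.mem_image, Finset.mem_image]
  change i = 0 ∨ i = 1 at hp
  rcases h with ⟨h1, h2⟩ | ⟨h1, h2⟩ <;> dsimp only at h1 h2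
  · rcases hp with rfl | rfl
    · exact absurd (by rw [h1, zero_add]) hq.2
    · rw [if_neg n10, if_neg n21.symm] at h2
      rw [fin_one_add_one] at h1
      subst h1 h2
      exact Or.inl ⟨a, Finset.mem_univ _, rfl⟩
  · rcases hp with rfl | rfl
    · have hj : j = -1 := eq_neg_of_add_eq_zero_left h1.symm
      have hj2 : j ≠ 2 := by
        rintro rfl
        rw [fin_two_add_one] at h1
        exact n30 h1.symm
      rw [if_neg hq.1, if_neg hj2] at h2
      subst h2 hj
      exact Or.inr ⟨b, Finset.mem_univ _, rfl⟩
    · exact absurd (left_eq_add.1 (h1.trans (add_comm _ _))) hq.1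

lemma CongestAlgorithm.RandomizedSolvesIn.sq_le {b : ℕ} {Ω : Type*} [MeasurableSpace Ω]
    {μ : Measure Ω} [IsProbabilityMeasure μ] {A : Ω → CongestAlgorithm n (k + 4) b} {T : ℕ}
    {P : ColoredGraphProblem n (k + 4)} (hA : RandomizedSolvesIn μ A T P)
    (hP1 : ∀ G c, HasMulticoloredInducedCycle n (k + 4) G c → P G c)
    (hP2 : ∀ G c, P G c → HasMulticoloredCycle n (k + 4) G c) (hm : (k + 4) * m ≤ n) :
    (m : ℝ) ^ 2 ≤ 4608 * (b * m * T) + 1152 := by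
  have hcard : Fintype.card (Fin (k + 4) × Fin m) ≤ Fintype.card (Fin n) := by simpa using hm
  obtain ⟨f⟩ := Function.Embedding.nonempty_of_card_le hcard
  -- Nodes outside the range of `f` are isolated, so their default color 0 is harmless.
  set c : Fin n → Fin (k + 4) := Function.extend f Prod.fst fun _ => 0 with hc
  have hcf : ∀ p, c (f p) = p.1 := fun p => f.injective.extend_apply _ _ p
  have h := hA.card_le (ι := Fin m × Fin m) (firstLayers f) (cutEdges f)
    (fun x y => (layeredGraph k x y).map f) c (map_layeredGraph_adj_congr_right f)
    (map_layeredGraph_adj_congr_left f) (mem_cutEdges f) fun x y =>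
      ⟨fun h => exists_mem_of_hasMulticoloredCycle f c hcf (hP2 _ _ h),
        fun h => hP1 _ _ (hasMulticoloredInducedCycle_of_mem f c hcf h)⟩
  have hcut : ((cutEdges f).card : ℝ) ≤ 2 * m := by exact_mod_cast card_cutEdges_le f
  have h2 : (b : ℝ) * (cutEdges f).card * T ≤ b * (2 * m) * T := by gcongr
  simp only [Fintype.card_prod, Fintype.card_fin, Nat.cast_mul] at h
  nlinarith

end LayeredGraph

/-! ### Both problems, both kinds of algorithms, and the constants. -/

lemma HasMulticoloredInducedCycle.hasMulticoloredCycle {n k : ℕ} {G : SimpleGraph (Fin n)}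
    {c : Fin n → Fin k} (h : HasMulticoloredInducedCycle n k G c) : HasMulticoloredCycle n k G c := by
  obtain ⟨φ, hφ⟩ := h
  exact ⟨φ.toCopy, hφ⟩

lemma CongestAlgorithm.SolvesIn.randomizedSolvesIn {n k b T : ℕ} {A : CongestAlgorithm n k b}
    {P : ColoredGraphProblem n k} (h : A.SolvesIn T P) {Ω : Type*} [MeasurableSpace Ω]
    (μ : Measure Ω) [IsProbabilityMeasure μ] : RandomizedSolvesIn μ (fun _ => A) T P := by
  intro G c
  have : {ω : Ω | A.AcceptsIn T G c ↔ P G c} = Set.univ := by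
    ext ω
    simp [h G c]
  rw [this, measure_univ]
  refine ⟨MeasurableSet.univ, ?_⟩
  rw [ENNReal.div_le_iff (by norm_num) (by norm_num)]
  norm_num

lemma le_rounds_of_sq_le {k n b m T : ℕ} {C : ℝ} (hC : 0 < C) (hk : 1 ≤ k)
    (hn : 48 * k ≤ n) (hm : m = n / k) (hb : (b : ℝ) ≤ C * Real.log n)
    (h : (m : ℝ) ^ 2 ≤ 4608 * (b * m * T) + 1152) :
    1 / (18432 * k * C) * (n / Real.log n) ≤ T := by
  have hkpos : 0 < k := hk
  have hm48 : 48 ≤ m := by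
    rw [hm, Nat.le_div_iff_mul_le hkpos]
    exact hn
  have hnm : n ≤ 2 * k * m := by
    have h1 := Nat.lt_mul_div_succ n hkpos
    rw [← hm] at h1
    nlinarith
  have hm48' : (48 : ℝ) ≤ m := by exact_mod_cast hm48
  have hnm' : (n : ℝ) ≤ 2 * k * m := by exact_mod_cast hnm
  have hkR : (0 : ℝ) < k := by exact_mod_cast hkpos
  have hlog : 0 < Real.log n := by
    apply Real.log_pos
    have : 1 < n := by nlinarith
    exact_mod_cast this
  have h1 : (m : ℝ) ≤ 9216 * (b * T) := by
    -- As `m ≥ 48`, the additive 1152 is at most `m ^ 2 / 2` and is absorbed by doubling 4608.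
    have : (m : ℝ) * m ≤ m * (9216 * (b * T)) := by nlinarith
    exact le_of_mul_le_mul_left this (by linarith)
  have h2 : (b : ℝ) * T ≤ C * Real.log n * T := by gcongr
  have h3 : (n : ℝ) ≤ 2 * k * (9216 * (C * Real.log n * T)) :=
    hnm'.trans (mul_le_mul_of_nonneg_left (by linarith) (by positivity))
  rw [div_mul_div_comm, one_mul, div_le_iff₀ (by positivity)]
  linarith

theorem mainTheorem11 (k : ℕ) (hk : 4 ≤ k) (C : ℝ) (hC : 0 < C) :
    ∃ α : ℝ, 0 < α ∧ ∃ n₀ : ℕ, ∀ n : ℕ, n₀ ≤ n → ∀ b : ℕ, (b : ℝ) ≤ C * Real.log n →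
      (∀ (A : CongestAlgorithm n k b) (T : ℕ),
        A.SolvesIn T (HasMulticoloredCycle n k) ∨
          A.SolvesIn T (HasMulticoloredInducedCycle n k) →
        α * (n / Real.log n) ≤ T) ∧
      (∀ (Ω : Type*) [MeasurableSpace Ω] (μ : Measure Ω) [IsProbabilityMeasure μ]
          (A : Ω → CongestAlgorithm n k b) (T : ℕ),
        CongestAlgorithm.RandomizedSolvesIn μ A T (HasMulticoloredCycle n k) ∨
          CongestAlgorithm.RandomizedSolvesIn μ A T (HasMulticoloredInducedCycle n k) →
        α * (n / Real.log n) ≤ T) := by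
  obtain ⟨k, rfl⟩ := Nat.exists_eq_add_of_le' hk
  refine ⟨1 / (18432 * (k + 4 : ℕ) * C), by positivity, 48 * (k + 4), fun n hn b hb => ?_⟩
  have hm : (k + 4) * (n / (k + 4)) ≤ n := Nat.mul_div_le n (k + 4)
  constructor
  · rintro A T (hA | hA)
    · exact le_rounds_of_sq_le hC (by omega) hn rfl hb
        -- A deterministic algorithm is a randomized one over a one-point seed space.
        ((hA.randomizedSolvesIn (Measure.dirac ())).sq_le
          (fun _ _ h => h.hasMulticoloredCycle) (fun _ _ h => h) hm)
    · exact le_rounds_of_sq_le hC (by omega) hn rfl hb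
        ((hA.randomizedSolvesIn (Measure.dirac ())).sq_le
          (fun _ _ h => h) (fun _ _ h => h.hasMulticoloredCycle) hm)
  · rintro Ω _ μ _ A T (hA | hA)
    · exact le_rounds_of_sq_le hC (by omega) hn rfl hb
        (hA.sq_le (fun _ _ h => h.hasMulticoloredCycle) (fun _ _ h => h) hm)
    · exact le_rounds_of_sq_le hC (by omega) hn rfl hb
        (hA.sq_le (fun _ _ h => h) (fun _ _ h => h.hasMulticoloredCycle) hm)
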